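/- Let $M$ be a finite-dimensional smooth (Hausdorff, boundaryless) manifold with a smooth pseudo-Riemannian (symmetric, nondegenerate, of any signature) metric $T_2$, and let $\pi\colon TM\to M$ be the tangent bundle. For $f\in C^\infty(M)$ let $\dot f\in C^\infty(TM)$ be the function $v_a\mapsto\langle df,v_a\rangle$, and let $\dot d$ be the operator $f\mapsto\dot f$. Let $\theta$ be the Liouville form on $TM$, $\theta_{v_a}=\pi^*(i_{v_a}T_2)$, let $\omega_2=d\theta$, and let $T(v_a)=\tfrac12T_2(v_a,v_a)$ be the kinetic energy. A second-order differential equation on $M$ is a smooth vector field $D$ on $TM$ with $D(f\circ\pi)=\dot f$ for all $f\in C^\infty(M)$; its work form is the 1-form $\alpha$ on $TM$ determined by Newton's equation $i_D\omega_2+dT+\alpha=0$. Let $\Omega$ be the contact system of $TM$, i.e. the smooth 1-forms on $TM$ that are incident with all second-order differential equations. For a smooth vector field $v$ on $M$, the infinitesimal variation $\delta_v$ is the smooth vector field $\delta$ on $TM$ that projects to $v$, is an infinitesimal contact transformation ($\mathcal L_\delta\Omega\subseteq\Omega$), and commutes with $\dot d$, i.e. $\dot d(vf)=\delta(\dot f)$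 for all $f\in C^\infty(M)$. 1. (Zentralgleichung) For every second-order differential equation $D$ with work form $\alpha$ and every infinitesimal variation $\delta=\delta_v$, one has on $TM$ $$D\langle\theta,\delta\rangle=\langle dT-\alpha,\delta\rangle .$$ 2. (Hamilton–Noether principle) Let $U\in C^\infty(M)$, let $D$ be the second-order differential equation of the conservative system $(M,T_2,dU)$, i.e. the one with work form $\alpha=\pi^*dU$, and let $L=T-U\circ\pi$ be its Lagrangian. For every infinitesimal variation $\delta$, one has on $TM$ $$D\langle\theta,\delta\rangle=\delta L .$$ 3. (Conserved quantities) In the situation of 2, if $\delta L=0$ on $TM$, then the function $\langle\theta,\delta\rangle$ is constant along every trajectory of the system, i.e. along every integral curve of $D$ defined on an interval of $\mathbb R$. -/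

import Mathlib

open scoped Manifold ContDiff
open Bundle

namespace HamiltonNoether

noncomputable section

/-! ### Derivations, one-forms, Lie derivative and exterior differential on a manifold -/

section Calculus

variable {F : Type*} [NormedAddCommGroup F] [NormedSpace ℝ F]
  {K : Type*} [TopologicalSpace K] (J : ModelWithCorners ℝ F K)
  {N : Type*} [TopologicalSpace N] [ChartedSpace K N]

/-- The differential `df` of a function `f`, as a field of covectors. -/
def differential (f : N → ℝ) (p : N) : TangentSpace J p →L[ℝ] ℝ :=
  mfderiv J 𝓘(ℝ, ℝ) f p

/-- The derivative `X f` of a function `f` along a vector field `X`. -/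
def derivAlong (X : (p : N) → TangentSpace J p) (f : N → ℝ) (p : N) : ℝ :=
  differential J f p (X p)

/-- The function `⟨η, X⟩` obtained by pairing a one-form with a vector field. -/
def pairing (η : (p : N) → TangentSpace J p →L[ℝ] ℝ) (X : (p : N) → TangentSpace J p)
    (p : N) : ℝ :=
  η p (X p)

variable [IsManifold J ∞ N]

/-- Smoothness of a vector field, as a section of the tangent bundle. -/
def IsSmoothField (X : (p : N) → TangentSpace J p) : Prop :=
  ContMDiff J J.tangent ∞ (fun p ↦ (TotalSpace.mk' F p (X p) : TangentBundle J N))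

/-- Smoothness of a one-form, as a section of the cotangent bundle. -/
def IsSmoothOneForm (η : (p : N) → TangentSpace J p →L[ℝ] ℝ) : Prop :=
  ContMDiff J (J.prod 𝓘(ℝ, F →L[ℝ] ℝ)) ∞ (fun p ↦ TotalSpace.mk' (F →L[ℝ] ℝ) p (η p))

/-- The Lie derivative of a one-form along `X`, evaluated on a vector field `Y`:
`(L_X η)(Y) = X (η(Y)) - η([X, Y])`. -/
def lieDerivOneForm (X : (p : N) → TangentSpace J p) (η : (p : N) → TangentSpace J p →L[ℝ] ℝ)
    (Y : (p : N) → TangentSpace J p) (p : N) : ℝ :=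
  derivAlong J X (pairing J η Y) p - η p (VectorField.mlieBracket J X Y p)

/-- The exterior differential of a one-form, evaluated on vector fields `X`, `Y`:
`dη(X, Y) = X (η(Y)) - Y (η(X)) - η([X, Y])`. -/
def extDerivOneForm (η : (p : N) → TangentSpace J p →L[ℝ] ℝ)
    (X Y : (p : N) → TangentSpace J p) (p : N) : ℝ :=
  derivAlong J X (pairing J η Y) p - derivAlong J Y (pairing J η X) p
    - η p (VectorField.mlieBracket J X Y p)

end Calculus

/-! ### The tangent bundle of the configuration space -/

section Mechanics

variable {E : Type*} [NormedAddCommGroup E] [NormedSpace ℝ E]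
  {M : Type*} [TopologicalSpace M] [ChartedSpace E M] [IsManifold 𝓘(ℝ, E) ∞ M]

variable (E M) in
/-- The tangent bundle `TM` of a manifold `M` modelled on `E`. -/
abbrev TM : Type _ := TangentBundle 𝓘(ℝ, E) M

/-- The differential at `p ∈ TM` of the canonical projection `π : TM → M`. -/
def projDeriv (p : TM E M) :
    TangentSpace 𝓘(ℝ, E).tangent p →L[ℝ] TangentSpace 𝓘(ℝ, E) p.proj :=
  mfderiv 𝓘(ℝ, E).tangent 𝓘(ℝ, E) (fun q : TM E M ↦ q.proj) p

/-- The function on `TM` defined by the differential of a function `f` on `M`: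
`v_a ↦ ⟨df, v_a⟩`. The operator `f ↦ dot f` is the tautological derivation from the smooth
functions on `M` to the smooth functions on `TM`. -/
def dot (f : M → ℝ) (p : TM E M) : ℝ :=
  differential 𝓘(ℝ, E) f p.proj p.2

/-- A second-order differential equation on `M`: a smooth vector field on `TM` which, as a
derivation from the functions on `M` to those on `TM`, coincides with `dot`. -/
structure IsSecondOrderEquation (D : (p : TM E M) → TangentSpace 𝓘(ℝ, E).tangent p) :
    Prop where
  smooth : IsSmoothField 𝓘(ℝ, E).tangent D
  eq_dot : ∀ f : M → ℝ, ContMDiff 𝓘(ℝ, E) 𝓘(ℝ, ℝ) ∞ f →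
    ∀ p : TM E M, derivAlong 𝓘(ℝ, E).tangent D (fun q ↦ f q.proj) p = dot f p

/-- Membership in the contact system of `TM`: the smooth one-forms that are incident with every
second-order differential equation. The values at `p` of (local) second-order equations are
exactly the vectors `w` at `p` with `π_* w = p`. -/
structure InContactSystem (σ : (p : TM E M) → TangentSpace 𝓘(ℝ, E).tangent p →L[ℝ] ℝ) :
    Prop where
  smooth : IsSmoothOneForm 𝓘(ℝ, E).tangent σ
  incident : ∀ (p : TM E M) (w : TangentSpace 𝓘(ℝ, E).tangent p),
    projDeriv p w = p.2 → σ p w = 0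

/-- An infinitesimal contact transformation of `TM`: a smooth vector field `δ` such that the Lie
derivative `L_δ σ` of every form `σ` of the contact system is again in the contact system, that
is, incident at each `p` with every vector `w` such that `π_* w = p`. -/
structure IsContactTransformation (δ : (p : TM E M) → TangentSpace 𝓘(ℝ, E).tangent p) :
    Prop where
  smooth : IsSmoothField 𝓘(ℝ, E).tangent δ
  lie_mem : ∀ σ : (p : TM E M) → TangentSpace 𝓘(ℝ, E).tangent p →L[ℝ] ℝ, InContactSystem σ →
    ∀ Y : (p : TM E M) → TangentSpace 𝓘(ℝ, E).tangent p, IsSmoothField 𝓘(ℝ, E).tangent Y →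
      ∀ p : TM E M, projDeriv p (Y p) = p.2 →
        lieDerivOneForm 𝓘(ℝ, E).tangent δ σ Y p = 0

/-- `δ` is the infinitesimal variation `δ_v` on `TM` over the vector field `v` on `M`: an
infinitesimal contact transformation which projects to `v` and satisfies Euler's commutation
formula `dot ∘ δ = δ ∘ dot` (on a function `f` on `M`, `δ` acts as `v`, because it projects
to `v`). -/
structure IsInfinitesimalVariation (v : (x : M) → TangentSpace 𝓘(ℝ, E) x)
    (δ : (p : TM E M) → TangentSpace 𝓘(ℝ, E).tangent p) : Prop where
  smooth_base : IsSmoothField 𝓘(ℝ, E) v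
  contact : IsContactTransformation δ
  projects : ∀ p : TM E M, projDeriv p (δ p) = v p.proj
  euler : ∀ f : M → ℝ, ContMDiff 𝓘(ℝ, E) 𝓘(ℝ, ℝ) ∞ f →
    ∀ p : TM E M, dot (derivAlong 𝓘(ℝ, E) v f) p = derivAlong 𝓘(ℝ, E).tangent δ (dot f) p

variable (E M) in
/-- A smooth pseudo-Riemannian (symmetric, nondegenerate) metric on `M`, of any signature. -/
structure PseudoRiemannianMetric where
  /-- The metric, as a bilinear form on each tangent space. -/
  form (x : M) : TangentSpace 𝓘(ℝ, E) x →L[ℝ] TangentSpace 𝓘(ℝ, E) x →L[ℝ] ℝ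
  symm (x : M) (u w : TangentSpace 𝓘(ℝ, E) x) : form x u w = form x w u
  nondegenerate (x : M) (u : TangentSpace 𝓘(ℝ, E) x) (hu : ∀ w, form x u w = 0) : u = 0
  contMDiff : ContMDiff 𝓘(ℝ, E) (𝓘(ℝ, E).prod 𝓘(ℝ, E →L[ℝ] E →L[ℝ] ℝ)) ∞
    (fun x ↦ TotalSpace.mk' (E →L[ℝ] E →L[ℝ] ℝ) x (form x))

/-- The Liouville form `θ`, transported to `TM` by the metric: at `v_a ∈ TM` it is the pull-back
to `TM` of the covector `i_{v_a} T₂` at `a`. -/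
def liouville (g : PseudoRiemannianMetric E M) (p : TM E M) :
    TangentSpace 𝓘(ℝ, E).tangent p →L[ℝ] ℝ :=
  (g.form p.proj p.2).comp (projDeriv p)

/-- The kinetic energy `T(v_a) = ½ T₂(v_a, v_a)`. -/
def kineticEnergy (g : PseudoRiemannianMetric E M) (p : TM E M) : ℝ :=
  (1 / 2) * g.form p.proj p.2 p.2

/-- Newton's equation `i_D ω₂ + dT + α = 0`, where `ω₂ = dθ`; it says that `α` is the work form
of the second-order equation `D`. The equation is written by evaluating the one-form on its left
side on an arbitrary smooth vector field `Y` on `TM`. -/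
def IsWorkForm (g : PseudoRiemannianMetric E M)
    (D : (p : TM E M) → TangentSpace 𝓘(ℝ, E).tangent p)
    (α : (p : TM E M) → TangentSpace 𝓘(ℝ, E).tangent p →L[ℝ] ℝ) : Prop :=
  ∀ Y : (p : TM E M) → TangentSpace 𝓘(ℝ, E).tangent p, IsSmoothField 𝓘(ℝ, E).tangent Y →
    ∀ p : TM E M,
      extDerivOneForm 𝓘(ℝ, E).tangent (liouville g) D Y p
        + derivAlong 𝓘(ℝ, E).tangent Y (kineticEnergy g) p + α p (Y p) = 0

/-- `D` is the second-order equation of motion of the conservative system `(M, T₂, dU)`: its work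
form is `dU`, pulled back to `TM`. -/
structure IsConservativeMotion (g : PseudoRiemannianMetric E M) (U : M → ℝ)
    (D : (p : TM E M) → TangentSpace 𝓘(ℝ, E).tangent p) : Prop where
  smooth_potential : ContMDiff 𝓘(ℝ, E) 𝓘(ℝ, ℝ) ∞ U
  secondOrder : IsSecondOrderEquation D
  newton : IsWorkForm g D (differential 𝓘(ℝ, E).tangent (fun p : TM E M ↦ U p.proj))

/-- The Lagrangian `L = T - U` of the conservative system `(M, T₂, dU)`. -/
def lagrangian (g : PseudoRiemannianMetric E M) (U : M → ℝ) (p : TM E M) : ℝ :=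
  kineticEnergy g p - U p.proj

end Mechanics

end

end HamiltonNoether

open HamiltonNoether

namespace HamiltonNoether

open Set
open scoped Topology

/-! Evaluating Newton's equation on `δ` and expanding dθ gives D⟨θ,δ⟩ - δ⟨θ,D⟩ - θ([D,δ]) + δT +
α(δ) = 0. Since `D` projects to the tautological field, ⟨θ,D⟩ = 2T, so the two energy terms combine
to -δT. The bracket is vertical and θ kills vertical vectors, so only D⟨θ,δ⟩ = δT - α(δ) remains.

Verticality (`projDeriv_mlieBracket_eq_zero`) is Euler's commutation formula: on `f ∘ π` the
commutator of `D` and `δ` is dot(vf) - δ(dot f) = 0. It rests on two facts: the bracket acts on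
functions as a commutator (`differential_mlieBracket`, checked in a chart), and global smooth
functions separate tangent vectors (`eq_of_forall_differential_eq`, by bump functions). With α =
d(U∘π) the right side is δL; if that vanishes, the mean value inequality gives conservation. -/

lemma two_le_infty : (2 : ℕ∞ω) ≤ ∞ := WithTop.coe_le_coe.2 (le_top : (2 : ℕ∞) ≤ ⊤)

/-! ### Vector fields in charts and the bracket as a commutator -/

section Calculus

variable {F : Type*} [NormedAddCommGroup F] [NormedSpace ℝ F]
  {K : Type*} [TopologicalSpace K] {J : ModelWithCorners ℝ F K}
  {N : Type*} [TopologicalSpace N] [ChartedSpace K N] [IsManifold J ∞ N]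

/-- In the chart at `p`, the derivative along a vector field is the derivative along its
coordinate expression. -/
lemma derivAlong_extChartAt_symm {X : (p : N) → TangentSpace J p} {f : N → ℝ} (p : N) {y : F}
    (hy : y ∈ (extChartAt J p).target)
    (hf : MDifferentiableAt J 𝓘(ℝ, ℝ) f ((extChartAt J p).symm y)) :
    derivAlong J X f ((extChartAt J p).symm y) =
      fderivWithin ℝ (f ∘ (extChartAt J p).symm) (range J) y
        (VectorField.mpullbackWithin 𝓘(ℝ, F) J (extChartAt J p).symm X (range J) y) := by
  have : IsManifold J 1 N := .of_le (n := ∞) (by simp)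
  have hyr : y ∈ range J := extChartAt_target_subset_range p hy
  have hs := mdifferentiableWithinAt_extChartAt_symm hy
  have hc := mfderivWithin_comp_of_eq (x := y) (g := f) hf.mdifferentiableWithinAt hs
    (subset_preimage_univ) (J.uniqueMDiffOn y hyr) rfl
  rw [← mfderivWithin_eq_fderivWithin, hc, mfderivWithin_univ]
  simp only [VectorField.mpullbackWithin_apply]
  -- The pullback applies the inverse of the derivative of the inverse chart; the chain rule applies
  -- that derivative again, and the two cancel.
  have hi := (isInvertible_mfderivWithin_extChartAt_symm hy).self_apply_inverse
    (X ((extChartAt J p).symm y))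
  exact (congrArg (mfderiv J 𝓘(ℝ, ℝ) f _) hi).symm

/-- The derivative of a smooth function along a smooth vector field is smooth. -/
lemma IsSmoothField.contMDiff_derivAlong {X : (p : N) → TangentSpace J p}
    (hX : IsSmoothField J X) {f : N → ℝ} (hf : ContMDiff J 𝓘(ℝ, ℝ) ∞ f) :
    ContMDiff J 𝓘(ℝ, ℝ) ∞ (derivAlong J X f) := by
  have h := (hf.contMDiff_tangentMap (m := ∞) (by simp)).comp hX
  exact (contMDiff_snd_tangentBundle_modelSpace ℝ 𝓘(ℝ, ℝ)).comp h

/-- The Lie bracket of two vector fields acts on functions as the commutator. -/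
theorem differential_mlieBracket [CompleteSpace F] {X Y : (p : N) → TangentSpace J p}
    (hX : IsSmoothField J X) (hY : IsSmoothField J Y) {f : N → ℝ}
    (hf : ContMDiff J 𝓘(ℝ, ℝ) ∞ f) (p : N) :
    differential J f p (VectorField.mlieBracket J X Y p) =
      derivAlong J X (derivAlong J Y f) p - derivAlong J Y (derivAlong J X f) p := by
  have : IsManifold J 2 N := .of_le (n := ∞) two_le_infty
  have : IsManifold J 1 N := .of_le (n := ∞) (by simp)
  have hfd : MDifferentiable J 𝓘(ℝ, ℝ) f := hf.mdifferentiable (by simp)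
  -- The coordinate formula holds on a whole neighbourhood within `range J`, so it may be
  -- differentiated once more.
  have hmem := mem_extChartAt_target (I := J) p
  have hev : ∀ Z : (p : N) → TangentSpace J p,
      derivAlong J Z f ∘ (extChartAt J p).symm =ᶠ[𝓝[range J] (extChartAt J p p)]
        fun y ↦ fderivWithin ℝ (f ∘ (extChartAt J p).symm) (range J) y
          (VectorField.mpullbackWithin 𝓘(ℝ, F) J (extChartAt J p).symm Z (range J) y) := by
    intro Z
    filter_upwards [extChartAt_target_mem_nhdsWithin (I := J) p] with y hy
    exact derivAlong_extChartAt_symm p hy (hfd _)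
  have key : ∀ Z W : (p : N) → TangentSpace J p, IsSmoothField J Z →
      derivAlong J W (derivAlong J Z f) p =
      fderivWithin ℝ (fun y ↦ fderivWithin ℝ (f ∘ (extChartAt J p).symm) (range J) y
          (VectorField.mpullbackWithin 𝓘(ℝ, F) J (extChartAt J p).symm Z (range J) y))
        (range J) (extChartAt J p p)
        (VectorField.mpullbackWithin 𝓘(ℝ, F) J (extChartAt J p).symm W (range J)
          (extChartAt J p p)) := by
    intro Z W hZ
    have h := derivAlong_extChartAt_symm (X := W) p hmem
      ((hZ.contMDiff_derivAlong hf).mdifferentiable (by simp) _)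
    rw [extChartAt_to_inv, (hev Z).fderivWithin_eq_of_mem (mem_range_self _)] at h
    exact h
  have hdiff : ∀ Z : (p : N) → TangentSpace J p, IsSmoothField J Z →
      DifferentiableWithinAt ℝ
        (VectorField.mpullbackWithin 𝓘(ℝ, F) J (extChartAt J p).symm Z (range J))
        (range J) (extChartAt J p p) := by
    intro Z hZ
    have h := MDifferentiableWithinAt.differentiableWithinAt_mpullbackWithin_vectorField
      (s := univ) ((hZ.mdifferentiable (by simp) p).mdifferentiableWithinAt)
    simpa using h
  have hcont : ContDiffWithinAt ℝ ∞ (f ∘ (extChartAt J p).symm) (range J)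
      (extChartAt J p p) := by
    have h := (contMDiffAt_iff.1 (hf p)).2
    simpa [extChartAt_model_space_eq_id] using! h
  -- In coordinates the second derivatives of `f` cancel by symmetry, which at boundary points of
  -- `range J` uses that they lie in the closure of its interior.
  rw [key Y X hY, key X Y hX, ← VectorField.fderivWithin_apply_lieBracket (n := ∞) hcont
    (by simpa using two_le_infty) J.uniqueDiffOn
    (J.range_subset_closure_interior (mem_range_self _)) (mem_range_self _)
    (hdiff Y hY) (hdiff X hX)]
  rw [← VectorField.mlieBracketWithin_univ, VectorField.mlieBracketWithin_apply]
  simp only [differential, preimage_univ, univ_inter]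
  -- The chart at `p` has identity derivative at `p`, so the coordinate bracket is already the
  -- bracket at `p`.
  rw [mfderiv_extChartAt_self, (hfd p).mfderiv]
  exact congrArg (fderivWithin ℝ (f ∘ (extChartAt J p).symm) (range J) (extChartAt J p p))
    (congrArg (fun A : F →L[ℝ] F ↦ A _) ContinuousLinearMap.inverse_id)

end Calculus
-- Second-order equations, variations and the Liouville form
section Mechanics

variable {E : Type*} [NormedAddCommGroup E] [NormedSpace ℝ E]
  {M : Type*} [TopologicalSpace M] [ChartedSpace E M] [IsManifold 𝓘(ℝ, E) ∞ M]

/-- Every covector at `x` is the differential at `x` of a globally defined smooth function. -/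
lemma exists_contMDiff_differential_eq [FiniteDimensional ℝ E] [T2Space M] (x : M)
    (l : E →L[ℝ] ℝ) :
    ∃ f : M → ℝ, ContMDiff 𝓘(ℝ, E) 𝓘(ℝ, ℝ) ∞ f ∧
      ∀ w : TangentSpace 𝓘(ℝ, E) x, differential 𝓘(ℝ, E) f x w = l w := by
  have : IsManifold 𝓘(ℝ, E) 1 M := .of_le (n := ∞) (by simp)
  obtain ⟨b⟩ : Nonempty (SmoothBumpFunction 𝓘(ℝ, E) x) := inferInstance
  let c : M → ℝ := fun y ↦ l (extChartAt 𝓘(ℝ, E) x y)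
  have hc : ContMDiffOn 𝓘(ℝ, E) 𝓘(ℝ, ℝ) ∞ c (chartAt E x).source :=
    l.contMDiff.comp_contMDiffOn contMDiffOn_extChartAt
  refine ⟨fun y ↦ b y • c y, b.contMDiff_smul hc, fun w ↦ ?_⟩
  -- The bump function is 1 near `x`, so cutting off does not change the differential there.
  have hev : (fun y ↦ b y • c y) =ᶠ[𝓝 x] c := by
    filter_upwards [b.eventuallyEq_one] with y hy
    simp [hy]
  have hd : HasMFDerivAt 𝓘(ℝ, E) 𝓘(ℝ, ℝ) c x
      (l.comp (mfderiv 𝓘(ℝ, E) 𝓘(ℝ, E) (extChartAt 𝓘(ℝ, E) x) x)) :=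
    HasMFDerivAt.comp x l.hasMFDerivAt
      (mdifferentiableAt_extChartAt (mem_chart_source E x)).hasMFDerivAt
  rw [differential, hev.mfderiv_eq, hd.mfderiv, mfderiv_extChartAt_self]
  rfl

/-- Smooth functions separate tangent vectors. -/
lemma eq_of_forall_differential_eq [FiniteDimensional ℝ E] [T2Space M] {x : M}
    {u w : TangentSpace 𝓘(ℝ, E) x}
    (h : ∀ f : M → ℝ, ContMDiff 𝓘(ℝ, E) 𝓘(ℝ, ℝ) ∞ f →
      differential 𝓘(ℝ, E) f x u = differential 𝓘(ℝ, E) f x w) : u = w := by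
  refine (SeparatingDual.eq_iff_forall_dual_eq (R := ℝ) (V := E)).2 fun l ↦ ?_
  obtain ⟨f, hf, hfl⟩ := exists_contMDiff_differential_eq x l
  rw [← hfl, ← hfl, h f hf]

lemma contMDiff_tangentBundle_proj :
    ContMDiff 𝓘(ℝ, E).tangent 𝓘(ℝ, E) ∞ (fun q : TM E M ↦ q.proj) :=
  contMDiff_proj (TangentSpace 𝓘(ℝ, E) : M → Type _)

/-- Chain rule for functions pulled back from the base. -/
lemma differential_comp_proj {f : M → ℝ} (hf : ContMDiff 𝓘(ℝ, E) 𝓘(ℝ, ℝ) ∞ f) (p : TM E M)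
    (w : TangentSpace 𝓘(ℝ, E).tangent p) :
    differential 𝓘(ℝ, E).tangent (fun q : TM E M ↦ f q.proj) p w =
      differential 𝓘(ℝ, E) f p.proj (projDeriv p w) := by
  have h := mfderiv_comp p (g := f) (f := fun q : TM E M ↦ q.proj)
    (hf.mdifferentiable (by simp) _) (contMDiff_tangentBundle_proj.mdifferentiable (by simp) p)
  exact congrArg (fun A ↦ A w) h

/-- A second-order equation projects to the tautological field. -/
lemma IsSecondOrderEquation.projDeriv_eq [FiniteDimensional ℝ E] [T2Space M]
    {D : (p : TM E M) → TangentSpace 𝓘(ℝ, E).tangent p} (hD : IsSecondOrderEquation D)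
    (p : TM E M) : projDeriv p (D p) = p.2 :=
  eq_of_forall_differential_eq fun f hf ↦
    (differential_comp_proj hf p (D p)).symm.trans (hD.eq_dot f hf p)

/-- The bracket of a second-order equation with an infinitesimal variation is vertical. -/
lemma projDeriv_mlieBracket_eq_zero [FiniteDimensional ℝ E] [T2Space M]
    {D δ : (p : TM E M) → TangentSpace 𝓘(ℝ, E).tangent p} {v : (x : M) → TangentSpace 𝓘(ℝ, E) x}
    (hD : IsSecondOrderEquation D) (hδ : IsInfinitesimalVariation v δ) (p : TM E M) :
    projDeriv p (VectorField.mlieBracket 𝓘(ℝ, E).tangent D δ p) = 0 := by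
  refine eq_of_forall_differential_eq fun f hf ↦ ?_
  have hfπ : ContMDiff 𝓘(ℝ, E).tangent 𝓘(ℝ, ℝ) ∞ (fun q : TM E M ↦ f q.proj) :=
    hf.comp contMDiff_tangentBundle_proj
  have h₁ : derivAlong 𝓘(ℝ, E).tangent D (fun q : TM E M ↦ f q.proj) = dot f :=
    funext (hD.eq_dot f hf)
  have h₂ : derivAlong 𝓘(ℝ, E).tangent δ (fun q : TM E M ↦ f q.proj) =
      fun q ↦ derivAlong 𝓘(ℝ, E) v f q.proj := by
    funext q
    rw [derivAlong, differential_comp_proj hf, hδ.projects, derivAlong]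
  have h₃ := hδ.smooth_base.contMDiff_derivAlong hf
  rw [← differential_comp_proj hf, differential_mlieBracket hD.smooth hδ.contact.smooth hfπ]
  rw [h₁, h₂, hD.eq_dot _ h₃, hδ.euler f hf, sub_self, map_zero]

/-- The function `p ↦ T₂(p, X(p))` is smooth for every smooth field `X` along the projection. -/
lemma PseudoRiemannianMetric.contMDiff_form (g : PseudoRiemannianMetric E M)
    {X : (p : TM E M) → TangentSpace 𝓘(ℝ, E) p.proj}
    (hX : ContMDiff 𝓘(ℝ, E).tangent 𝓘(ℝ, E).tangent ∞
      (fun p : TM E M ↦ (TotalSpace.mk' E p.proj (X p) : TM E M))) :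
    ContMDiff 𝓘(ℝ, E).tangent 𝓘(ℝ, ℝ) ∞ (fun p : TM E M ↦ g.form p.proj p.2 (X p)) := by
  have hg := g.contMDiff.comp (contMDiff_tangentBundle_proj (E := E) (M := M))
  have hid : ContMDiff 𝓘(ℝ, E).tangent 𝓘(ℝ, E).tangent ∞
      (fun p : TM E M ↦ (TotalSpace.mk' E p.proj p.2 : TM E M)) := contMDiff_id
  have h := ContMDiff.clm_bundle_apply₂ (F₁ := E) (F₂ := E) (F₃ := ℝ)
    (E₃ := Bundle.Trivial M ℝ) (b := fun p : TM E M ↦ p.proj)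
    (ψ := fun p ↦ g.form p.proj) (v := fun p ↦ p.2) (w := X) hg hid hX
  intro p
  have hp := h p
  simp only [contMDiffAt_totalSpace] at hp
  exact hp.2

lemma contMDiff_kineticEnergy (g : PseudoRiemannianMetric E M) :
    ContMDiff 𝓘(ℝ, E).tangent 𝓘(ℝ, ℝ) ∞ (kineticEnergy g) :=
  contMDiff_const.mul (g.contMDiff_form (X := fun p ↦ p.2) contMDiff_id)

/-- θ sees only the projection of `δ`, so smoothness of the pairing reduces to that of the metric
and of `v`. -/
lemma IsInfinitesimalVariation.pairing_liouville {g : PseudoRiemannianMetric E M}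
    {v : (x : M) → TangentSpace 𝓘(ℝ, E) x}
    {δ : (p : TM E M) → TangentSpace 𝓘(ℝ, E).tangent p} (hδ : IsInfinitesimalVariation v δ) :
    pairing 𝓘(ℝ, E).tangent (liouville g) δ = fun p ↦ g.form p.proj p.2 (v p.proj) := by
  funext p
  rw [← hδ.projects p]
  rfl

lemma IsInfinitesimalVariation.contMDiff_pairing_liouville {g : PseudoRiemannianMetric E M}
    {v : (x : M) → TangentSpace 𝓘(ℝ, E) x}
    {δ : (p : TM E M) → TangentSpace 𝓘(ℝ, E).tangent p} (hδ : IsInfinitesimalVariation v δ) :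
    ContMDiff 𝓘(ℝ, E).tangent 𝓘(ℝ, ℝ) ∞ (pairing 𝓘(ℝ, E).tangent (liouville g) δ) := by
  rw [hδ.pairing_liouville]
  exact g.contMDiff_form (X := fun p ↦ v p.proj)
    (hδ.smooth_base.comp contMDiff_tangentBundle_proj)

/-- The central equation `D⟨θ, δ⟩ = ⟨dT - α, δ⟩`. -/
theorem central_equation [FiniteDimensional ℝ E] [T2Space M] {g : PseudoRiemannianMetric E M}
    {D δ : (p : TM E M) → TangentSpace 𝓘(ℝ, E).tangent p}
    {α : (p : TM E M) → TangentSpace 𝓘(ℝ, E).tangent p →L[ℝ] ℝ}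
    {v : (x : M) → TangentSpace 𝓘(ℝ, E) x} (hD : IsSecondOrderEquation D)
    (hα : IsWorkForm g D α) (hδ : IsInfinitesimalVariation v δ) (p : TM E M) :
    derivAlong 𝓘(ℝ, E).tangent D (pairing 𝓘(ℝ, E).tangent (liouville g) δ) p =
      (differential 𝓘(ℝ, E).tangent (kineticEnergy g) p - α p) (δ p) := by
  have hN := hα δ hδ.contact.smooth p
  -- The factor 2 undoes the ½ in `T`, leaving -2δT + δT = -δT in Newton's equation.
  have hθD : pairing 𝓘(ℝ, E).tangent (liouville g) D = (2 : ℝ) • kineticEnergy g := by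
    funext q
    change g.form q.proj q.2 (projDeriv q (D q)) = 2 * (1 / 2 * g.form q.proj q.2 q.2)
    rw [hD.projDeriv_eq]
    ring
  have hθb : liouville g p (VectorField.mlieBracket 𝓘(ℝ, E).tangent D δ p) = 0 := by
    change g.form p.proj p.2 (projDeriv p _) = 0
    rw [projDeriv_mlieBracket_eq_zero hD hδ, map_zero]
  have hδT : derivAlong 𝓘(ℝ, E).tangent δ ((2 : ℝ) • kineticEnergy g) p =
      2 * derivAlong 𝓘(ℝ, E).tangent δ (kineticEnergy g) p := by
    rw [derivAlong, differential, const_smul_mfderiv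
      ((contMDiff_kineticEnergy g).mdifferentiable (by simp) p)]
    rfl
  rw [extDerivOneForm, hθD, hθb, hδT] at hN
  change _ = derivAlong 𝓘(ℝ, E).tangent δ (kineticEnergy g) p - α p (δ p)
  linarith

/-- The Hamilton–Noether principle `D⟨θ, δ⟩ = δL`. -/
theorem hamilton_noether [FiniteDimensional ℝ E] [T2Space M] {g : PseudoRiemannianMetric E M}
    {U : M → ℝ} {D δ : (p : TM E M) → TangentSpace 𝓘(ℝ, E).tangent p}
    {v : (x : M) → TangentSpace 𝓘(ℝ, E) x} (hD : IsConservativeMotion g U D)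
    (hδ : IsInfinitesimalVariation v δ) (p : TM E M) :
    derivAlong 𝓘(ℝ, E).tangent D (pairing 𝓘(ℝ, E).tangent (liouville g) δ) p =
      derivAlong 𝓘(ℝ, E).tangent δ (lagrangian g U) p := by
  have hT := (contMDiff_kineticEnergy g).mdifferentiable (by simp) p
  have hU := (hD.smooth_potential.comp (contMDiff_tangentBundle_proj (E := E))).mdifferentiable
    (by simp) p
  rw [central_equation hD.secondOrder hD.newton hδ]
  exact congrArg (fun A ↦ A (δ p)) (hT.hasMFDerivAt.sub hU.hasMFDerivAt).mfderiv.symm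

end Mechanics

/-! ### Constancy along trajectories -/

section IntegralCurves

variable {F : Type*} [NormedAddCommGroup F] [NormedSpace ℝ F]
  {K : Type*} [TopologicalSpace K] {J : ModelWithCorners ℝ F K}
  {N : Type*} [TopologicalSpace N] [ChartedSpace K N]

/-- A function whose derivative along a vector field vanishes is constant along the integral
curves of the field. -/
lemma eq_of_isMIntegralCurveOn_of_derivAlong_eq_zero {X : (p : N) → TangentSpace J p}
    {f : N → ℝ} (hf : MDifferentiable J 𝓘(ℝ, ℝ) f) (h₀ : ∀ p, derivAlong J X f p = 0)
    {s : Set ℝ} (hs : s.OrdConnected) {γ : ℝ → N} (hγ : IsMIntegralCurveOn γ X s) {t₁ t₂ : ℝ}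
    (h₁ : t₁ ∈ s) (h₂ : t₂ ∈ s) : f (γ t₁) = f (γ t₂) := by
  have hd : ∀ t ∈ s, HasDerivWithinAt (f ∘ γ) 0 s t := by
    intro t ht
    have h := (hf (γ t)).hasMFDerivAt.comp_hasMFDerivWithinAt t (hγ t ht)
    let A : ℝ →L[ℝ] ℝ :=
      (mfderiv J 𝓘(ℝ, ℝ) f (γ t)).comp ((1 : ℝ →L[ℝ] ℝ).smulRight (X (γ t)))
    have h' : HasFDerivWithinAt (f ∘ γ) A s t := hasMFDerivWithinAt_iff_hasFDerivWithinAt.1 h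
    have hA : A 1 = 0 :=
      (congrArg (mfderiv J 𝓘(ℝ, ℝ) f (γ t)) (one_smul ℝ (X (γ t)))).trans (h₀ (γ t))
    exact hA ▸ h'.hasDerivWithinAt
  -- An order-connected set of reals is convex, and derivatives within `s` suffice, so endpoints
  -- need no separate treatment.
  have h := hs.convex.norm_image_sub_le_of_norm_hasDerivWithin_le (C := 0) hd (by simp) h₂ h₁
  simpa [sub_eq_zero] using h

end IntegralCurves

end HamiltonNoether

theorem mainTheorem11 {E : Type*} [NormedAddCommGroup E] [NormedSpace ℝ E]
    [FiniteDimensional ℝ E] {M : Type*} [TopologicalSpace M] [ChartedSpace E M]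
    [IsManifold 𝓘(ℝ, E) ∞ M] [T2Space M] (g : PseudoRiemannianMetric E M) :
    -- the central equation `D⟨θ, δ⟩ = ⟨dT - α, δ⟩`
    (∀ (D : (p : TM E M) → TangentSpace 𝓘(ℝ, E).tangent p)
        (α : (p : TM E M) → TangentSpace 𝓘(ℝ, E).tangent p →L[ℝ] ℝ),
      IsSecondOrderEquation D → IsWorkForm g D α →
      ∀ (v : (x : M) → TangentSpace 𝓘(ℝ, E) x)
        (δ : (p : TM E M) → TangentSpace 𝓘(ℝ, E).tangent p),
        IsInfinitesimalVariation v δ → ∀ p : TM E M,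
          derivAlong 𝓘(ℝ, E).tangent D (pairing 𝓘(ℝ, E).tangent (liouville g) δ) p =
            (differential 𝓘(ℝ, E).tangent (kineticEnergy g) p - α p) (δ p)) ∧
    -- conservative systems: `D⟨θ, δ⟩ = δL`, and conservation of `⟨θ, δ⟩` for symmetries
    (∀ (U : M → ℝ) (D : (p : TM E M) → TangentSpace 𝓘(ℝ, E).tangent p),
      IsConservativeMotion g U D →
      ∀ (v : (x : M) → TangentSpace 𝓘(ℝ, E) x)
        (δ : (p : TM E M) → TangentSpace 𝓘(ℝ, E).tangent p),
        IsInfinitesimalVariation v δ →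
          (∀ p : TM E M,
            derivAlong 𝓘(ℝ, E).tangent D (pairing 𝓘(ℝ, E).tangent (liouville g) δ) p =
              derivAlong 𝓘(ℝ, E).tangent δ (lagrangian g U) p) ∧
          ((∀ p : TM E M, derivAlong 𝓘(ℝ, E).tangent δ (lagrangian g U) p = 0) →
            ∀ (s : Set ℝ) (γ : ℝ → TM E M), s.OrdConnected → IsMIntegralCurveOn γ D s →
              ∀ t₁ ∈ s, ∀ t₂ ∈ s,
                pairing 𝓘(ℝ, E).tangent (liouville g) δ (γ t₁) =
                  pairing 𝓘(ℝ, E).tangent (liouville g) δ (γ t₂))) := by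
  refine ⟨fun D α hD hα v δ hδ p ↦ central_equation hD hα hδ p, fun U D hD v δ hδ ↦
    ⟨hamilton_noether hD hδ, fun hL s γ hs hγ t₁ h₁ t₂ h₂ ↦ ?_⟩⟩
  exact eq_of_isMIntegralCurveOn_of_derivAlong_eq_zero
    (hδ.contMDiff_pairing_liouville.mdifferentiable (by simp))
    (fun p ↦ (hamilton_noether hD hδ p).trans (hL p)) hs hγ h₁ h₂
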